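/- Let $d\ge 2$ and $p\in[0,1]$. Let $V$ be the swap on $\mathbb C^d\otimes\mathbb C^d$, let $P_s=\frac12(I+V)$ and $P_{as}=\frac12(I-V)$ be the projectors onto the symmetric and antisymmetric subspaces, $d_s=\frac{d(d+1)}2$ and $d_{as}=\frac{d(d-1)}2$ their ranks, and let $$\rho_W(p)=p\,\frac{P_s}{d_s}+(1-p)\,\frac{P_{as}}{d_{as}}$$ be the Werner state. For a completely positive (not necessarily trace-preserving) map $\Lambda$ from operators on $AB=\mathbb C^d\otimes\mathbb C^d$ to operators on two qubits $ab$, and a state $\rho$ with $\operatorname{tr}\Lambda(\rho)\neq0$, put $$F(\rho,\Lambda)=\frac{\operatorname{tr}(\Lambda(\rho)\,\Phi^+)}{\operatorname{tr}\Lambda(\rho)},\qquad \Phi^+=|\phi_+\rangle\langle\phi_+|,\quad |\phi_+\rangle=\tfrac1{\sqrt2}(|00\rangle+|11\rangle).$$ The map $\Lambda$ is called *1-extendible* if its (not necessarily normalized) Choi–Jamiołkowski operator $\sigma_{A'B'ab}=(\mathrm{id}\otimes\Lambda)(\Phi^+_{A'A}\otimes\Phi^+_{B'B})$, where here $\Phi^+_{A'A}$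 and $\Phi^+_{B'B}$ are maximally entangled states on $\mathbb C^d\otimes\mathbb C^d$, is 1-extendible in the cut $A'a:B'b$, i.e. there is a positive semidefinite operator on $A'a\,B_0'b_0\,B_1'b_1$ whose reductions to $A'a\,B_0'b_0$ and to $A'a\,B_1'b_1$ both equal $\sigma_{A'B'ab}$. It is a *1-extendible measure-and-prepare map* if there are states $\sigma_{ABE}$ on $(\mathbb C^d)^{\otimes3}$ and $\sigma_{abe}$ on $(\mathbb C^2)^{\otimes3}$ such that $$\Lambda(\rho)=\operatorname{tr}(\rho\,\sigma_{AB})\,\sigma_{ab}+\operatorname{tr}(\rho\,\sigma_{AE})\,\sigma_{ae}$$ for all $\rho$, where $\sigma_{AB},\sigma_{AE},\sigma_{ab},\sigma_{ae}$ are the indicated reductions. Set $$f(p,d)=\frac{\sqrt3\,|-2dp+d+1|}{\sqrt{(2(d-2)p+d+1)(3(d+1)-2(d+2)p)}},\qquad \gamma=-\frac{2dp-d-1}{2p-d-1}.$$ Then the maximum of $F(\rho_W(p),\Lambda)$ over all 1-extendible measure-and-prepare maps $\Lambda$ with $\operatorname{tr}\Lambda(\rho_W(p))\ne0$ is attained and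 equals $$\frac14\left(\sqrt{3f(p,d)^2+1}+2\right).$$ The maximum of $F(\rho_W(p),\Lambda)$ over all 1-extendible maps $\Lambda$ with $\operatorname{tr}\Lambda(\rho_W(p))\neq0$ is attained and has the same value. Moreover $\rho_W(p)=\dfrac{I+\gamma V}{d^2+\gamma d}$, and this common value equals $$\frac12+\frac12\sqrt{\frac{1+2\gamma^2}{4-\gamma^2}}.$$ -/

import Mathlib

open scoped Matrix ComplexOrder

/-- A (normalized) quantum state on the space with basis `n`. -/
def IsState {n : Type*} [Fintype n] (ρ : Matrix n n ℂ) : Prop :=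
  ρ.PosSemidef ∧ ρ.trace = 1

/-- The maximally entangled vector `|ϕ₊⟩ = D^{-1/2} ∑ᵢ |i i⟩`, `D = |n|`. -/
noncomputable def phiVec (n : Type*) [Fintype n] [DecidableEq n] : n × n → ℂ :=
  fun x => if x.1 = x.2 then (((Real.sqrt (Fintype.card n))⁻¹ : ℝ) : ℂ) else 0

/-- The maximally entangled state `Φ⁺ = |ϕ₊⟩⟨ϕ₊|`. -/
noncomputable def phiPlus (n : Type*) [Fintype n] [DecidableEq n] :
    Matrix (n × n) (n × n) ℂ :=
  Matrix.vecMulVec (phiVec n) (star (phiVec n))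

/-- The map `id ⊗ Λ`, where the identity acts on the operators on an ancilla with basis `κ`. -/
def ampliation {n m : Type*} (κ : Type*) (Λ : Matrix n n ℂ →ₗ[ℂ] Matrix m m ℂ)
    (X : Matrix (κ × n) (κ × n) ℂ) : Matrix (κ × m) (κ × m) ℂ :=
  Matrix.of fun x y => Λ (Matrix.of fun s t => X (x.1, s) (y.1, t)) x.2 y.2

/-- Complete positivity (no condition on the trace). -/
def IsCompletelyPositive {n m : Type*} (Λ : Matrix n n ℂ →ₗ[ℂ] Matrix m m ℂ) : Prop :=
  ∀ (r : ℕ) (X : Matrix (Fin r × n) (Fin r × n) ℂ),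
    X.PosSemidef → (ampliation (Fin r) Λ X).PosSemidef

/-- The reduction of an operator on `A ⊗ B ⊗ E` to `A ⊗ B` (trace over `E`). -/
def reduceAB {A B E : Type*} [Fintype E] (σ : Matrix (A × B × E) (A × B × E) ℂ) :
    Matrix (A × B) (A × B) ℂ :=
  Matrix.of fun x y => ∑ e, σ (x.1, x.2, e) (y.1, y.2, e)

/-- The reduction of an operator on `A ⊗ B ⊗ E` to `A ⊗ E` (trace over `B`). -/
def reduceAE {A B E : Type*} [Fintype B] (σ : Matrix (A × B × E) (A × B × E) ℂ) :
    Matrix (A × E) (A × E) ℂ :=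
  Matrix.of fun x y => ∑ b, σ (x.1, b, x.2) (y.1, b, y.2)

/-- A bipartite, not necessarily normalized state `τ` on `A ⊗ B` is 1-extendible (on Bob's site)
if some positive operator on `A ⊗ B ⊗ B` has both of its `A ⊗ B` reductions equal to `τ`. -/
def IsOneExtendible {A B : Type*} [Fintype B] (τ : Matrix (A × B) (A × B) ℂ) : Prop :=
  τ.PosSemidef ∧ ∃ ω : Matrix (A × B × B) (A × B × B) ℂ,
    ω.PosSemidef ∧ reduceAB ω = τ ∧ reduceAE ω = τ

/-- Linear maps from operators on `AB = ℂ^d ⊗ ℂ^d` to operators on the two qubits `ab`. -/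
abbrev DistMap (d : ℕ) : Type :=
  Matrix (Fin d × Fin d) (Fin d × Fin d) ℂ →ₗ[ℂ] Matrix (Fin 2 × Fin 2) (Fin 2 × Fin 2) ℂ

/-- The Choi-Jamiolkowski operator `(id ⊗ Λ)(Φ⁺_{A'A} ⊗ Φ⁺_{B'B})`, with the four systems
`A' B' a b` regrouped into Alice's `A' a` and Bob's `B' b`. The operator
`Φ⁺_{A'A} ⊗ Φ⁺_{B'B}` is the maximally entangled state between `A'B'` and `AB`. -/
noncomputable def choi {d : ℕ} (Λ : DistMap d) :
    Matrix ((Fin d × Fin 2) × (Fin d × Fin 2)) ((Fin d × Fin 2) × (Fin d × Fin 2)) ℂ :=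
  (ampliation (Fin d × Fin d) Λ (phiPlus (Fin d × Fin d))).submatrix
    (fun x => ((x.1.1, x.2.1), (x.1.2, x.2.2))) (fun x => ((x.1.1, x.2.1), (x.1.2, x.2.2)))

/-- 1-extendible maps: completely positive maps whose Choi-Jamiolkowski operator is 1-extendible
with respect to the cut `Aa : Bb`. -/
def IsOneExtendibleMap {d : ℕ} (Λ : DistMap d) : Prop :=
  IsCompletelyPositive Λ ∧ IsOneExtendible (choi Λ)

/-- 1-extendible measure-and-prepare maps: for states `σ_{ABE}` and `σ_{abe}`,
`Λ(ρ) = tr(ρ σ_{AB}) σ_{ab} + tr(ρ σ_{AE}) σ_{ae}`. -/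
def IsOneExtendibleMeasurePrepare {d : ℕ} (Λ : DistMap d) : Prop :=
  ∃ (σin : Matrix (Fin d × Fin d × Fin d) (Fin d × Fin d × Fin d) ℂ)
    (σout : Matrix (Fin 2 × Fin 2 × Fin 2) (Fin 2 × Fin 2 × Fin 2) ℂ),
    IsState σin ∧ IsState σout ∧
    ∀ ρ : Matrix (Fin d × Fin d) (Fin d × Fin d) ℂ,
      Λ ρ = (ρ * reduceAB σin).trace • reduceAB σout
        + (ρ * reduceAE σin).trace • reduceAE σout

/-- `F(ρ, Λ) = tr(Λ(ρ) Φ⁺) / tr(Λ(ρ))` (a real number when `Λ` is completely positive and `ρ` is a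
state with `tr(Λ(ρ)) ≠ 0`). -/
noncomputable def fidelity {d : ℕ} (ρ : Matrix (Fin d × Fin d) (Fin d × Fin d) ℂ)
    (Λ : DistMap d) : ℝ :=
  ((Λ ρ * phiPlus (Fin 2)).trace / (Λ ρ).trace).re

/-- The fidelities achievable from `ρ`, with nonzero probability, by the maps of a class `C`. -/
def achievableFidelities {d : ℕ} (C : DistMap d → Prop)
    (ρ : Matrix (Fin d × Fin d) (Fin d × Fin d) ℂ) : Set ℝ :=
  {F | ∃ Λ : DistMap d, C Λ ∧ (Λ ρ).trace ≠ 0 ∧ F = fidelity ρ Λ}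

/-- The swap `V` of the two subsystems of `ℂ^d ⊗ ℂ^d`. -/
def swapOp (d : ℕ) : Matrix (Fin d × Fin d) (Fin d × Fin d) ℂ :=
  Matrix.of fun x y => if x.1 = y.2 ∧ x.2 = y.1 then 1 else 0

/-- The projector onto the symmetric subspace. -/
noncomputable def symProj (d : ℕ) : Matrix (Fin d × Fin d) (Fin d × Fin d) ℂ :=
  (1 / 2 : ℂ) • (1 + swapOp d)

/-- The projector onto the antisymmetric subspace. -/
noncomputable def asymProj (d : ℕ) : Matrix (Fin d × Fin d) (Fin d × Fin d) ℂ :=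
  (1 / 2 : ℂ) • (1 - swapOp d)

/-- The Werner state `p P_s / d_s + (1 - p) P_as / d_as`, where `d_s = d (d + 1) / 2` and
`d_as = d (d - 1) / 2`. -/
noncomputable def wernerState (d : ℕ) (p : ℝ) : Matrix (Fin d × Fin d) (Fin d × Fin d) ℂ :=
  ((p / ((d : ℝ) * (d + 1) / 2) : ℝ) : ℂ) • symProj d
    + (((1 - p) / ((d : ℝ) * (d - 1) / 2) : ℝ) : ℂ) • asymProj d

/-- The normalized Werner state proportional to `I + γ V`. -/
noncomputable def wernerStateGamma (d : ℕ) (γ : ℝ) : Matrix (Fin d × Fin d) (Fin d × Fin d) ℂ :=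
  (((d : ℝ) ^ 2 + γ * d)⁻¹ : ℂ) • (1 + (γ : ℂ) • swapOp d)

/-- The function `f(p, d)`. -/
noncomputable def wernerF (p : ℝ) (d : ℕ) : ℝ :=
  Real.sqrt 3 * |-2 * d * p + d + 1| /
    Real.sqrt ((2 * ((d : ℝ) - 2) * p + d + 1) * (3 * ((d : ℝ) + 1) - 2 * ((d : ℝ) + 2) * p))

/-- The parameter `γ` of the Werner state with parameter `p`. -/
noncomputable def wernerGamma (p : ℝ) (d : ℕ) : ℝ :=
  -((2 * d * p - d - 1) / (2 * p - d - 1))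

/-! With `g = γ` and `s = √((1 + 2g²)/(4 - g²))`, the Werner state is proportional to `1 + gV`, and
both maxima equal `(1 + s)/2`. Measure-and-prepare maps of the given form are 1-extendible, so it
suffices to bound the larger class and attain the bound in the smaller one.

Upper bound. Pair the Choi operator of `Λ` with `ρ ⊗ ((1 + s)/2 - Φ⁺)`, and average over the two
reductions of an extension `ω`. This turns the fidelity gap into a nonnegative multiple of a pairing
of `ω` with `(1 + gV_AB) ⊗ (1 + s - 2Φ_ab) + (1 + gV_AE) ⊗ (1 + s - 2Φ_ae)`, so positivity of this
operator is enough (`werner_fidelity_gap_nonneg`). The two swaps generate `S₃`, while `2Φ_ab` and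
`2Φ_ae` commute with them and satisfy Temperley-Lieb relations with loop parameter 2. Positivity is
therefore checked on isotypic blocks (`posSemidef_transposition_temperleyLieb`). The one hard block
pairs the standard representation of `S₃` with the nontrivial Temperley-Lieb component. There the
operator is a combination of Pauli-type products, and the equation for `s` makes it positive
(`posSemidef_pauli`).

Attainment. Pure input and output states are taken in copies of the standard representation, each
described by a unit vector `(z, x)` in the plane. Optimizing the fidelity over the two vectors gives
`(1 + s)/2` (`exists_measurePrepare_fidelity`). -/

namespace Matrix

/-! ### Positivity in the algebra of `S₃` and Temperley-Lieb generators. -/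

/-- A Hermitian matrix with `H² = 2 H` is positive. -/
theorem posSemidef_of_mul_self_eq_two_smul {n : Type*} [Fintype n] {H : Matrix n n ℂ} (hH : H.IsHermitian)
    (h : H * H = (2 : ℂ) • H) : H.PosSemidef := by
  have := (posSemidef_conjTranspose_mul_self H).smul (show (0 : ℝ) ≤ 1 / 2 by norm_num)
  rw [hH.eq, h] at this
  convert this using 1
  module

variable {n : Type*} [Fintype n] [DecidableEq n]

/-- The operator `M` of two commuting Pauli-type triples `(p, Z₁, Y₁)`, `(q, Z₂, Y₂)` is positive. -/
theorem posSemidef_pauli {p q Z₁ Y₁ Z₂ Y₂ : Matrix n n ℂ}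
    (hp : p.IsHermitian) (hq : q.IsHermitian) (hZ₁ : Z₁.IsHermitian) (hY₁ : Y₁.IsHermitian)
    (hZ₂ : Z₂.IsHermitian) (hY₂ : Y₂.IsHermitian)
    (pp : p * p = p) (pZ : p * Z₁ = Z₁) (Zp : Z₁ * p = Z₁) (pY : p * Y₁ = Y₁) (Yp : Y₁ * p = Y₁)
    (ZZ : Z₁ * Z₁ = p) (YY : Y₁ * Y₁ = (3 : ℂ) • p) (YZ : Y₁ * Z₁ = -(Z₁ * Y₁))
    (qq : q * q = q) (qZ : q * Z₂ = Z₂) (Zq : Z₂ * q = Z₂) (qY : q * Y₂ = Y₂) (Yq : Y₂ * q = Y₂)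
    (ZZ₂ : Z₂ * Z₂ = q) (YY₂ : Y₂ * Y₂ = (3 : ℂ) • q) (YZ₂ : Y₂ * Z₂ = -(Z₂ * Y₂))
    (qp : q * p = p * q) (qZ₁ : q * Z₁ = Z₁ * q) (qY₁ : q * Y₁ = Y₁ * q)
    (Zp₂ : Z₂ * p = p * Z₂) (ZZ₁ : Z₂ * Z₁ = Z₁ * Z₂) (ZY₁ : Z₂ * Y₁ = Y₁ * Z₂)
    (Yp₂ : Y₂ * p = p * Y₂) (YZ₁ : Y₂ * Z₁ = Z₁ * Y₂) (YY₁ : Y₂ * Y₁ = Y₁ * Y₂)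
    {g s : ℝ} (hg : |g| ≤ 1) (hs : 1 / 2 ≤ s) (h : s ^ 2 * (4 - g ^ 2) = 1 + 2 * g ^ 2) :
    ((2 * s : ℂ) • (p * q) + (s * g : ℂ) • (Z₁ * q) + p * Z₂ + (g / 2 : ℂ) • (Z₁ * Z₂)
      + (g / 2 : ℂ) • (Y₁ * Y₂)).PosSemidef := by
  set M := (2 * s : ℂ) • (p * q) + (s * g : ℂ) • (Z₁ * q) + p * Z₂ + (g / 2 : ℂ) • (Z₁ * Z₂)
      + (g / 2 : ℂ) • (Y₁ * Y₂) with hM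
  have hMH : Mᴴ = M := by
    simp only [hM, conjTranspose_add, conjTranspose_smul, conjTranspose_mul, hp.eq, hq.eq, hZ₁.eq,
      hY₁.eq, hZ₂.eq, hY₂.eq, qp, qZ₁, Zp₂, ZZ₁, YY₁]
    simp
  set P := Z₁ * Z₂ with hP
  have hPH : Pᴴ = P := by rw [hP, conjTranspose_mul, hZ₁.eq, hZ₂.eq, ZZ₁]
  have tail : ∀ {x y z : Matrix n n ℂ}, x * y = z → ∀ w, x * (y * w) = z * w := by
    rintro x y z rfl w; rw [mul_assoc]
  -- With `N = 4s·pq - gP` and `c = 16s² - g² > 0`, the identity `M N M = c M` makes `M = c⁻¹ M N M`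
  -- a congruence of `N`, so positivity of `N` passes to `M`. This is where the equation for `s`
  -- enters.
  have key : M * ((4 * s : ℂ) • (p * q) - (g : ℂ) • P) * M = (16 * s ^ 2 - g ^ 2 : ℂ) • M := by
    have hc : (s : ℂ) ^ 2 * (4 - g ^ 2) = 1 + 2 * g ^ 2 := by exact_mod_cast h
    simp only [hM, hP, add_mul, mul_add, sub_mul, mul_sub, smul_mul_assoc, mul_smul_comm, mul_assoc,
      qq, qZ, Zq, qY, Yq, ZZ₂, YY₂, YZ₂, tail pp, tail pZ, tail Zp, tail pY, tail Yp, tail ZZ,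
      tail YY, tail YZ, tail ZZ₂, tail qp, tail qZ₁, tail qY₁, tail Zp₂, tail ZZ₁, tail ZY₁,
      tail Yp₂, tail YZ₁, tail YY₁, neg_mul, mul_neg,
      neg_neg, smul_neg]
    match_scalars <;>
      first
      | ring1
      | linear_combination (-4 * s : ℂ) * hc
      | linear_combination (g : ℂ) * hc
  -- `P² = pq`, so `pq ± P` are positive. `N` combines them with weights `2s ∓ g/2`, which are
  -- nonnegative because `s ≥ 1/2` and `|g| ≤ 1`.
  have hP1 : ((4 * s : ℂ) • (p * q) - (g : ℂ) • P).PosSemidef := by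
    have e1 : (p * q) * (p * q) = p * q := by
      simp only [mul_assoc, tail qp, tail pp, qq]
    have e2 : (p * q - P) * (p * q - P) = (2 : ℂ) • (p * q - P) := by
      simp only [hP, sub_mul, mul_sub, mul_assoc, tail qp, tail pp, qq, tail qZ₁, tail pZ, qZ,
        tail Zp₂, tail Zp, Zq, tail ZZ₁, tail ZZ, ZZ₂]
      module
    have e3 : (p * q + P) * (p * q + P) = (2 : ℂ) • (p * q + P) := by
      simp only [hP, add_mul, mul_add, mul_assoc, tail qp, tail pp, qq, tail qZ₁, tail pZ, qZ,
        tail Zp₂, tail Zp, Zq, tail ZZ₁, tail ZZ, ZZ₂]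
      module
    have hpq : (p * q)ᴴ = p * q := by rw [conjTranspose_mul, hp.eq, hq.eq, qp]
    have f2 : (p * q - P).PosSemidef :=
      posSemidef_of_mul_self_eq_two_smul (by rw [IsHermitian, conjTranspose_sub, hpq, hPH]) e2
    have f3 : (p * q + P).PosSemidef :=
      posSemidef_of_mul_self_eq_two_smul (by rw [IsHermitian, conjTranspose_add, hpq, hPH]) e3
    have hg' := abs_le.1 hg
    have := (f2.smul (show (0 : ℝ) ≤ 2 * s + g / 2 by linarith)).add
      (f3.smul (show (0 : ℝ) ≤ 2 * s - g / 2 by linarith))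
    convert this using 1
    match_scalars <;> simp <;> ring
  have hpos : 0 < 16 * s ^ 2 - g ^ 2 := by nlinarith [abs_le.1 hg, sq_abs g, abs_nonneg g]
  have := (hP1.conjTranspose_mul_mul_same M).smul (inv_nonneg.2 hpos.le)
  rw [hMH, key] at this
  convert this using 1
  have : ((16 * s ^ 2 - g ^ 2 : ℝ) : ℂ) ≠ 0 := by exact_mod_cast hpos.ne'
  push_cast at this
  rw [← Complex.coe_smul, smul_smul]
  push_cast
  rw [inv_mul_cancel₀ this, one_smul]

/-- `1 + g a` is positive for an involution `a` and `|g| ≤ 1`. -/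
theorem posSemidef_one_add_smul {a : Matrix n n ℂ} (ha : a.IsHermitian) (aa : a * a = 1)
    {g : ℝ} (hg : |g| ≤ 1) : (1 + (g : ℂ) • a).PosSemidef := by
  have h1 : (1 + a).PosSemidef := posSemidef_of_mul_self_eq_two_smul
    (by rw [IsHermitian, conjTranspose_add, ha.eq, conjTranspose_one])
    (by simp only [add_mul, mul_add, aa, one_mul, mul_one]; module)
  have h2 : (1 - a).PosSemidef := posSemidef_of_mul_self_eq_two_smul
    (by rw [IsHermitian, conjTranspose_sub, ha.eq, conjTranspose_one])
    (by simp only [sub_mul, mul_sub, aa, one_mul, mul_one]; module)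
  have hg' := abs_le.1 hg
  have := (h1.smul (show (0 : ℝ) ≤ (1 + g) / 2 by linarith)).add
    (h2.smul (show (0 : ℝ) ≤ (1 - g) / 2 by linarith))
  convert this using 1
  match_scalars <;> simp <;> ring

/-- The operator inequality behind the upper bound: `a`, `b` are transpositions generating `S₃`,
`e`, `f` are commuting with them and generate a Temperley-Lieb algebra with loop parameter `2`. -/
theorem posSemidef_transposition_temperleyLieb {a b e f : Matrix n n ℂ}
    (ha : a.IsHermitian) (hb : b.IsHermitian) (he : e.IsHermitian) (hf : f.IsHermitian)
    (aa : a * a = 1) (bb : b * b = 1) (bab : b * (a * b) = a * (b * a))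
    (ee : e * e = (2 : ℂ) • e) (ff : f * f = (2 : ℂ) • f)
    (efe : e * (f * e) = e) (fef : f * (e * f) = f)
    (ea : e * a = a * e) (eb : e * b = b * e) (fa : f * a = a * f) (fb : f * b = b * f)
    {g s : ℝ} (hg : |g| ≤ 1) (hs : 1 / 2 ≤ s) (h : s ^ 2 * (4 - g ^ 2) = 1 + 2 * g ^ 2) :
    ((1 + (g : ℂ) • a) * ((1 + s : ℂ) • 1 - e)
      + (1 + (g : ℂ) • b) * ((1 + s : ℂ) • 1 - f)).PosSemidef := by
  have tail : ∀ {x y z : Matrix n n ℂ}, x * y = z → ∀ w, x * (y * w) = z * w := by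
    rintro x y z rfl w; rw [mul_assoc]
  have tail3 : ∀ {x y z v : Matrix n n ℂ}, x * (y * z) = v → ∀ w, x * (y * (z * w)) = v * w := by
    rintro x y z v rfl w; simp only [mul_assoc]
  have ta := tail aa
  have tb := tail bb
  have tbab := tail3 bab
  have te := tail ee
  have tf := tail ff
  have tea := tail ea
  have teb := tail eb
  have tfa := tail fa
  have tfb := tail fb
  simp only [mul_assoc] at ta tb tbab te tf tea teb tfa tfb
  -- `t`, `u`, `p` are the central idempotents of `S₃` for the trivial, sign and standard
  -- representations; `q` is the unit of the Temperley-Lieb component generated by `e` and `f`.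
  set p : Matrix n n ℂ := (1 / 3 : ℂ) • ((2 : ℂ) • 1 - a * b - b * a) with hp
  set t : Matrix n n ℂ := (1 / 6 : ℂ) • (1 + a + b + a * b + b * a + a * (b * a)) with ht
  set u : Matrix n n ℂ := (1 / 6 : ℂ) • (1 - a - b + a * b + b * a - a * (b * a)) with hu
  set q : Matrix n n ℂ := (1 / 3 : ℂ) • ((2 : ℂ) • e + (2 : ℂ) • f - e * f - f * e) with hq
  -- In the standard representation `a + b + aba = 0`, so `Z₁` is `a + b` cut down by `p`. With `Y₁
  -- = a - b`, `e + f = 2q - Z₂` and `f - e = Y₂`, both pairs anticommute and square to the unit and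
  -- three times the unit of their blocks.
  set Z₁ : Matrix n n ℂ := (1 / 3 : ℂ) • (a + b - (2 : ℂ) • (a * (b * a))) with hZ₁
  set Z₂ : Matrix n n ℂ := (2 : ℂ) • q - e - f with hZ₂
  set Y₁ : Matrix n n ℂ := a - b with hY₁
  set Y₂ : Matrix n n ℂ := f - e with hY₂
  have Hp : p.IsHermitian := by
    rw [IsHermitian, hp]
    simp [conjTranspose_mul, ha.eq, hb.eq]
    module
  have Hq : q.IsHermitian := by
    rw [IsHermitian, hq]
    simp [conjTranspose_mul, he.eq, hf.eq]
    module
  have Ht : t.IsHermitian := by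
    rw [IsHermitian, ht]
    simp [conjTranspose_mul, ha.eq, hb.eq, mul_assoc]
    module
  have Hu : u.IsHermitian := by
    rw [IsHermitian, hu]
    simp [conjTranspose_mul, ha.eq, hb.eq, mul_assoc]
    module
  have HZ₁ : Z₁.IsHermitian := by
    rw [IsHermitian, hZ₁]
    simp [conjTranspose_mul, ha.eq, hb.eq, mul_assoc]
  have HZ₂ : Z₂.IsHermitian := by
    rw [IsHermitian, hZ₂]
    simp [he.eq, hf.eq, Hq.eq]
  have HY₁ : Y₁.IsHermitian := ha.sub hb
  have HY₂ : Y₂.IsHermitian := hf.sub he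
  have tt : t * t = t := by
    simp only [ht, smul_mul_assoc, mul_smul_comm, add_mul, mul_add, mul_assoc, one_mul, mul_one,
      aa, ta, bb, tb, bab, tbab]
    module
  have uu : u * u = u := by
    simp only [hu, smul_mul_assoc, mul_smul_comm, add_mul, mul_add, sub_mul, mul_sub, mul_assoc,
      one_mul, mul_one, aa, ta, bb, tb, bab, tbab]
    module
  have qq : q * q = q := by
    simp only [hq, smul_mul_assoc, mul_smul_comm, add_mul, mul_add, sub_mul, mul_sub, mul_assoc,
      ee, te, ff, tf, efe, fef]
    module
  have comm : ∀ {x : Matrix n n ℂ}, x * a = a * x → x * b = b * x →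
      x * p = p * x ∧ x * t = t * x ∧ x * u = u * x ∧ x * Z₁ = Z₁ * x ∧ x * Y₁ = Y₁ * x := by
    intro x xa xb
    refine ⟨?_, ?_, ?_, ?_, ?_⟩ <;>
      simp only [hp, ht, hu, hZ₁, hY₁, smul_mul_assoc, mul_smul_comm, add_mul, mul_add, sub_mul,
        mul_sub, mul_assoc, one_mul, mul_one, xa, xb, tail xa, tail xb]
  have qa : q * a = a * q := by
    simp only [hq, smul_mul_assoc, mul_smul_comm, add_mul, mul_add, sub_mul, mul_sub, mul_assoc,
      ea, tea, fa, tfa]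
  have qb : q * b = b * q := by
    simp only [hq, smul_mul_assoc, mul_smul_comm, add_mul, mul_add, sub_mul, mul_sub, mul_assoc,
      eb, teb, fb, tfb]
  have Za : Z₂ * a = a * Z₂ := by
    simp only [hZ₂, smul_mul_assoc, mul_smul_comm, sub_mul, mul_sub, qa, ea, fa]
  have Zb : Z₂ * b = b * Z₂ := by
    simp only [hZ₂, smul_mul_assoc, mul_smul_comm, sub_mul, mul_sub, qb, eb, fb]
  have Ya : Y₂ * a = a * Y₂ := by simp only [hY₂, sub_mul, mul_sub, ea, fa]
  have Yb : Y₂ * b = b * Y₂ := by simp only [hY₂, sub_mul, mul_sub, eb, fb]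
  obtain ⟨qp, qt, qu, qZ₁, qY₁⟩ := comm qa qb
  obtain ⟨Zp, Zt, Zu, ZZ₁, ZY₁⟩ := comm Za Zb
  obtain ⟨Yp, -, -, YZ₁, YY₁⟩ := comm Ya Yb
  have qZ : q * Z₂ = Z₂ := by
    simp only [hZ₂, mul_sub, mul_smul_comm, qq]
    simp only [hq, smul_mul_assoc, mul_smul_comm, add_mul, sub_mul, mul_assoc,
      ee, ff, efe, fef]
    module
  have Zq : Z₂ * q = Z₂ := by
    simp only [hZ₂, sub_mul, smul_mul_assoc, qq]
    simp only [hq, smul_mul_assoc, mul_smul_comm, mul_add, mul_sub,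
      ee, te, ff, tf, efe, fef]
    module
  have ZZ₂ : Z₂ * Z₂ = q := by
    simp only [hZ₂, hq, smul_mul_assoc, mul_smul_comm, add_mul, mul_add, sub_mul, mul_sub,
      mul_assoc, ee, te, ff, tf, efe, fef]
    module
  have hM := posSemidef_pauli (p := p) (q := q) (Z₁ := Z₁) (Y₁ := Y₁) (Z₂ := Z₂) (Y₂ := Y₂)
    Hp Hq HZ₁ HY₁ HZ₂ HY₂
    (by simp only [hp, smul_mul_assoc, mul_smul_comm, sub_mul, mul_sub, mul_assoc, one_mul,
          mul_one, aa, ta, bb, tb, bab, tbab]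
        module)
    (by simp only [hp, hZ₁, smul_mul_assoc, mul_smul_comm, mul_add, sub_mul, mul_sub,
          mul_assoc, one_mul, mul_one, aa, ta, bb, tb, bab, tbab]
        module)
    (by simp only [hp, hZ₁, smul_mul_assoc, mul_smul_comm, add_mul, sub_mul, mul_sub,
          mul_assoc, one_mul, mul_one, aa, ta, bb, tb, bab, tbab]
        module)
    (by simp only [hp, hY₁, smul_mul_assoc, sub_mul, mul_sub,
          mul_assoc, one_mul, mul_one, aa, bb, bab]
        module)
    (by simp only [hp, hY₁, mul_smul_comm, sub_mul, mul_sub,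
          one_mul, mul_one, ta, tb, bab]
        module)
    (by simp only [hp, hZ₁, smul_mul_assoc, mul_smul_comm, add_mul, mul_add, sub_mul, mul_sub,
          mul_assoc, one_mul, mul_one, aa, ta, bb, tb, bab, tbab]
        module)
    (by simp only [hp, hY₁, sub_mul, mul_sub, aa, bb]
        module)
    (by simp only [hZ₁, hY₁, smul_mul_assoc, mul_smul_comm, add_mul, mul_add, sub_mul, mul_sub,
          mul_assoc, one_mul, mul_one, aa, ta, bb, bab, tbab]
        module)
    qq qZ Zq
    (by simp only [hq, hY₂, smul_mul_assoc, add_mul, sub_mul, mul_sub, mul_assoc,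
          ee, ff, efe, fef, mul_smul_comm]
        module)
    (by simp only [hq, hY₂, mul_smul_comm, mul_add, sub_mul, mul_sub,
          ee, te, ff, tf, efe, fef, smul_mul_assoc]
        module)
    ZZ₂
    (by simp only [hq, hY₂, sub_mul, mul_sub, ee, ff]
        module)
    (by simp only [hZ₂, hq, hY₂, smul_mul_assoc, mul_smul_comm, add_mul, mul_add, sub_mul, mul_sub,
          mul_assoc, ee, te, ff, tf, efe, fef]
        module)
    qp qZ₁ qY₁ Zp ZZ₁ ZY₁ Yp YZ₁ YY₁ hg hs h
  have hg' := abs_le.1 hg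
  -- `2sq + Z₂` is `2(1 + s) - e - f` on the range of `q`. It is the operator left when `a = b =
  -- ±1`, up to the factor `1 ± g`.
  have hN : ((2 * s : ℂ) • q + Z₂).PosSemidef := by
    have h1 : q.PosSemidef := by
      have := posSemidef_conjTranspose_mul_self q
      rwa [Hq.eq, qq] at this
    have h2 : (q + Z₂).PosSemidef := posSemidef_of_mul_self_eq_two_smul (Hq.add HZ₂)
      (by simp only [add_mul, mul_add, qq, qZ, Zq, ZZ₂]; module)
    convert (h1.smul (show (0 : ℝ) ≤ 2 * s - 1 by linarith)).add h2 using 1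
    clear_value q Z₂
    match_scalars <;> push_cast [Complex.coe_algebraMap] <;> ring
  have hT := (hN.conjTranspose_mul_mul_same t).smul (show (0 : ℝ) ≤ 1 + g by linarith)
  have hU := (hN.conjTranspose_mul_mul_same u).smul (show (0 : ℝ) ≤ 1 - g by linarith)
  -- On the complement of `q` both `e` and `f` vanish, leaving `(1 + s)(2 + g(a + b))`.
  have hQ := (((posSemidef_one_add_smul ha aa hg).add
    (posSemidef_one_add_smul hb bb hg)).conjTranspose_mul_mul_same (1 - q)).smul
      (show (0 : ℝ) ≤ 1 + s by linarith)
  rw [Ht.eq, mul_assoc, show ((2 * s : ℂ) • q + Z₂) * t = t * ((2 * s : ℂ) • q + Z₂) by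
    simp only [add_mul, mul_add, smul_mul_assoc, mul_smul_comm, qt, Zt], ← mul_assoc, tt] at hT
  rw [Hu.eq, mul_assoc, show ((2 * s : ℂ) • q + Z₂) * u = u * ((2 * s : ℂ) • q + Z₂) by
    simp only [add_mul, mul_add, smul_mul_assoc, mul_smul_comm, qu, Zu], ← mul_assoc, uu] at hU
  have hR : (1 - q)ᴴ * (1 + (g : ℂ) • a + (1 + (g : ℂ) • b)) * (1 - q)
      = ((2 : ℂ) • 1 + (g : ℂ) • (a + b)) * (1 - q) := by
    simp only [conjTranspose_sub, conjTranspose_one, Hq.eq, smul_mul_assoc, mul_smul_comm, add_mul,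
      mul_add, sub_mul, mul_sub, mul_assoc, one_mul, mul_one, qq, qa, qb]
    module
  rw [hR] at hQ
  -- The decomposition `1 = (1 - q) + q(t + u + p)` splits the operator into its four blocks.
  convert ((hQ.add hT).add hU).add hM using 1
  simp only [hp, ht, hu, hZ₁, hY₁, hY₂, hZ₂, hq, smul_mul_assoc, mul_smul_comm, add_mul, mul_add,
    sub_mul, mul_sub, mul_assoc, one_mul, mul_one]
  match_scalars <;> push_cast [Complex.coe_algebraMap] <;> ring

end Matrix

/-! ### Contractions and reductions of positive operators. -/

namespace Matrix

theorem PosSemidef.kroneckerMap_mul {m n : Type*} [Finite m] [Finite n] {X : Matrix m m ℂ}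
    {S : Matrix n n ℂ} (hX : X.PosSemidef) (hS : S.PosSemidef) :
    (kroneckerMap (fun a b => a * b) X S).PosSemidef :=
  hX.kronecker hS

/-- Contracting the second tensor factor of a positive operator with a positive operator gives a
positive operator. -/
theorem PosSemidef.contract {κ n : Type*} [Finite κ] [Fintype n]
    {X : Matrix (κ × n) (κ × n) ℂ} {S : Matrix n n ℂ} (hX : X.PosSemidef) (hS : S.PosSemidef) :
    (Matrix.of fun x y => ∑ s, ∑ t, X (x, s) (y, t) * S s t : Matrix κ κ ℂ).PosSemidef := by
  classical
  have := Fintype.ofFinite κ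
  -- `B` sends `k` to `∑ₛ |k, s, s⟩`; compressing `X ⊗ S` by it contracts the two copies of `n`.
  let B : Matrix ((κ × n) × n) κ ℂ := Matrix.of fun u k => if u.1.1 = k ∧ u.1.2 = u.2 then 1 else 0
  convert (hX.kroneckerMap_mul hS).conjTranspose_mul_mul_same B using 1
  ext x y
  have h1 : ∀ (p q : Prop) [Decidable p] [Decidable q] (a : ℂ),
      (if p ∧ q then a else 0) = if p then (if q then a else 0) else 0 := by
    intro p q _ _ a; split_ifs <;> simp_all
  simp [Matrix.mul_apply, Matrix.kroneckerMap_apply, B, Fintype.sum_prod_type, h1,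
    apply_ite (starRingEnd ℂ), ite_mul]
  rw [Finset.sum_comm]

theorem PosSemidef.sum_mul_nonneg {n : Type*} [Fintype n] {X S : Matrix n n ℂ}
    (hX : X.PosSemidef) (hS : S.PosSemidef) : 0 ≤ ∑ s, ∑ t, X s t * S s t :=
  ((hX.submatrix (Prod.snd : Unit × n → n)).contract hS).diag_nonneg (i := ())

theorem PosSemidef.reduceAB {A B E : Type*} [Fintype E]
    {σ : Matrix (A × B × E) (A × B × E) ℂ} (h : σ.PosSemidef) : (reduceAB σ).PosSemidef := by
  convert posSemidef_sum Finset.univ fun e _ =>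
    h.submatrix (fun x : A × B => (x.1, x.2, e)) using 1
  ext x y
  simp [_root_.reduceAB, Matrix.sum_apply]

theorem PosSemidef.reduceAE {A B E : Type*} [Fintype B]
    {σ : Matrix (A × B × E) (A × B × E) ℂ} (h : σ.PosSemidef) : (reduceAE σ).PosSemidef := by
  convert posSemidef_sum Finset.univ fun b _ =>
    h.submatrix (fun x : A × E => (x.1, b, x.2)) using 1
  ext x y
  simp [_root_.reduceAE, Matrix.sum_apply]

end Matrix

open Matrix

/-- The partial trace is dual to tensoring with the identity, here for the entrywise pairing `tr(X
Kᵀ)`. -/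
theorem sum_reduceAB_mul {A B E : Type*} [Fintype A] [Fintype B] [Fintype E] [DecidableEq E]
    (ω : Matrix (A × B × E) (A × B × E) ℂ) (K : Matrix (A × B) (A × B) ℂ) :
    ∑ x, ∑ y, reduceAB ω x y * K x y = ∑ z, ∑ w, ω z w *
      (K (z.1, z.2.1) (w.1, w.2.1) * if z.2.2 = w.2.2 then 1 else 0) := by
  simp only [Fintype.sum_prod_type, reduceAB, Matrix.of_apply, Finset.sum_mul, mul_ite, mul_one,
    mul_zero, Finset.sum_ite_eq, Finset.mem_univ, if_true]
  refine Finset.sum_congr rfl fun a _ => Finset.sum_congr rfl fun b _ => ?_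
  rw [Finset.sum_comm_cycle]

theorem sum_reduceAE_mul {A B E : Type*} [Fintype A] [Fintype B] [Fintype E] [DecidableEq B]
    (ω : Matrix (A × B × E) (A × B × E) ℂ) (K : Matrix (A × E) (A × E) ℂ) :
    ∑ x, ∑ y, reduceAE ω x y * K x y = ∑ z, ∑ w, ω z w *
      (K (z.1, z.2.2) (w.1, w.2.2) * if z.2.1 = w.2.1 then 1 else 0) := by
  have h := sum_reduceAB_mul (ω.submatrix (fun z : A × E × B => (z.1, z.2.2, z.2.1))
    (fun z : A × E × B => (z.1, z.2.2, z.2.1))) K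
  have e : ∀ f : A × B × E → ℂ, ∑ z : A × E × B, f (z.1, z.2.2, z.2.1) = ∑ z, f z := fun f =>
    Fintype.sum_equiv ((Equiv.refl A).prodCongr (Equiv.prodComm E B)) _ _ fun _ => rfl
  refine h.trans ?_
  rw [← e]
  refine Finset.sum_congr rfl fun z _ => ?_
  rw [← e]
  rfl

/-! ### The Choi operator, and extendibility of measure-and-prepare maps. -/

theorem choi_apply {d : ℕ} (Λ : DistMap d) (x y : Fin d × Fin d) (m m' : Fin 2 × Fin 2) :
    choi Λ ((x.1, m.1), (x.2, m.2)) ((y.1, m'.1), (y.2, m'.2))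
      = ((d : ℂ) ^ 2)⁻¹ * Λ (Matrix.single x y 1) m m' := by
  have : (Matrix.of fun s t => phiPlus (Fin d × Fin d) (x, s) (y, t))
      = ((d : ℂ) ^ 2)⁻¹ • Matrix.single x y 1 := by
    ext s t
    simp only [phiPlus, vecMulVec_apply, phiVec, Matrix.of_apply, Matrix.smul_apply,
      Matrix.single_apply, Pi.star_apply, smul_eq_mul, Fintype.card_prod, Fintype.card_fin,
      Nat.cast_mul, Real.sqrt_mul_self (Nat.cast_nonneg d)]
    by_cases h1 : x = s <;> by_cases h2 : y = t <;> simp [h1, h2]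
    ring
  simp only [choi, ampliation, Matrix.submatrix_apply, Matrix.of_apply, Prod.mk.eta, this,
    map_smul, Matrix.smul_apply, smul_eq_mul]

/-- `tr(Λ(ρ) Y)` in terms of the Choi operator of `Λ`. -/
theorem trace_apply_mul_eq_sum_choi {d : ℕ} (hd : d ≠ 0) (Λ : DistMap d)
    (ρ : Matrix (Fin d × Fin d) (Fin d × Fin d) ℂ) (Y : Matrix (Fin 2 × Fin 2) (Fin 2 × Fin 2) ℂ) :
    (Λ ρ * Y).trace = (d : ℂ) ^ 2 * ∑ x, ∑ y, choi Λ x y *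
      (ρ (x.1.1, x.2.1) (y.1.1, y.2.1) * Y (y.1.2, y.2.2) (x.1.2, x.2.2)) := by
  have hρ : Λ ρ = ∑ x, ∑ y, ρ x y • Λ (Matrix.single x y 1) := by
    conv_lhs => rw [Matrix.matrix_eq_sum_single ρ]
    simp only [map_sum]
    refine Finset.sum_congr rfl fun x _ => Finset.sum_congr rfl fun y _ => ?_
    rw [← map_smul, Matrix.smul_single, smul_eq_mul, mul_one]
  have e : ∀ f : (Fin d × Fin 2) × (Fin d × Fin 2) → ℂ, ∑ z, f z
      = ∑ x : Fin d × Fin d, ∑ m : Fin 2 × Fin 2, f ((x.1, m.1), (x.2, m.2)) := by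
    intro f
    rw [← Fintype.sum_prod_type']
    exact Fintype.sum_equiv (Equiv.prodProdProdComm _ _ _ _) _ _ fun _ => rfl
  rw [e]
  simp only [e, choi_apply]
  have hd' : (d : ℂ) ^ 2 ≠ 0 := by positivity
  simp only [hρ, Matrix.trace, Matrix.diag_apply, Matrix.mul_apply, Matrix.sum_apply,
    Matrix.smul_apply, smul_eq_mul, Finset.mul_sum, Finset.sum_mul]
  rw [Finset.sum_comm]
  refine Finset.sum_congr rfl fun x _ => Finset.sum_congr rfl fun m _ =>
    Finset.sum_congr rfl fun y _ => Finset.sum_congr rfl fun m' _ => ?_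
  simp only [Prod.mk.eta]
  field_simp

section MeasurePrepare

variable {d : ℕ} {Λ : DistMap d}
  {S : Matrix (Fin d × Fin d × Fin d) (Fin d × Fin d × Fin d) ℂ}
  {T : Matrix (Fin 2 × Fin 2 × Fin 2) (Fin 2 × Fin 2 × Fin 2) ℂ}

theorem ampliation_posSemidef_of_measurePrepare (hS : S.PosSemidef) (hT : T.PosSemidef)
    (hΛ : ∀ ρ, Λ ρ = (ρ * reduceAB S).trace • reduceAB T + (ρ * reduceAE S).trace • reduceAE T)
    {κ : Type*} [Finite κ] {X : Matrix (κ × (Fin d × Fin d)) (κ × (Fin d × Fin d)) ℂ}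
    (hX : X.PosSemidef) : (ampliation κ Λ X).PosSemidef := by
  convert ((hX.contract hS.reduceAB.transpose).kroneckerMap_mul hT.reduceAB).add
    ((hX.contract hS.reduceAE.transpose).kroneckerMap_mul hT.reduceAE) using 1
  ext x y
  simp [ampliation, hΛ, Matrix.trace, Matrix.mul_apply, kroneckerMap_apply]

theorem choi_apply_of_measurePrepare
    (hΛ : ∀ ρ, Λ ρ = (ρ * reduceAB S).trace • reduceAB T + (ρ * reduceAE S).trace • reduceAE T)
    (x y : (Fin d × Fin 2) × (Fin d × Fin 2)) :
    choi Λ x y = ((d : ℂ) ^ 2)⁻¹ *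
      (reduceAB S (y.1.1, y.2.1) (x.1.1, x.2.1) * reduceAB T (x.1.2, x.2.2) (y.1.2, y.2.2)
      + reduceAE S (y.1.1, y.2.1) (x.1.1, x.2.1) * reduceAE T (x.1.2, x.2.2) (y.1.2, y.2.2)) := by
  refine (choi_apply Λ (x.1.1, x.2.1) (y.1.1, y.2.1) (x.1.2, x.2.2) (y.1.2, y.2.2)).trans ?_
  rw [hΛ]
  simp [Matrix.trace_single_mul]

/-- The extension of the Choi operator of a measure-and-prepare map. -/
noncomputable def measurePrepareExtension
    (S : Matrix (Fin d × Fin d × Fin d) (Fin d × Fin d × Fin d) ℂ)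
    (T : Matrix (Fin 2 × Fin 2 × Fin 2) (Fin 2 × Fin 2 × Fin 2) ℂ) :
    Matrix ((Fin d × Fin 2) × (Fin d × Fin 2) × (Fin d × Fin 2))
      ((Fin d × Fin 2) × (Fin d × Fin 2) × (Fin d × Fin 2)) ℂ :=
  ((d : ℝ) ^ 2)⁻¹ • ((kroneckerMap (fun a b => a * b) Sᵀ T).submatrix
      (fun z => ((z.1.1, z.2.1.1, z.2.2.1), (z.1.2, z.2.1.2, z.2.2.2)))
      (fun z => ((z.1.1, z.2.1.1, z.2.2.1), (z.1.2, z.2.1.2, z.2.2.2)))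
    + (kroneckerMap (fun a b => a * b) Sᵀ T).submatrix
      (fun z => ((z.1.1, z.2.2.1, z.2.1.1), (z.1.2, z.2.2.2, z.2.1.2)))
      (fun z => ((z.1.1, z.2.2.1, z.2.1.1), (z.1.2, z.2.2.2, z.2.1.2))))

theorem measurePrepareExtension_posSemidef (hS : S.PosSemidef) (hT : T.PosSemidef) :
    (measurePrepareExtension S T).PosSemidef :=
  (((hS.transpose.kroneckerMap_mul hT).submatrix _).add
    ((hS.transpose.kroneckerMap_mul hT).submatrix _)).smul
      (inv_nonneg.2 (sq_nonneg (d : ℝ)))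

theorem reduceAB_measurePrepareExtension
    (hΛ : ∀ ρ, Λ ρ = (ρ * reduceAB S).trace • reduceAB T + (ρ * reduceAE S).trace • reduceAE T) :
    reduceAB (measurePrepareExtension S T) = choi Λ := by
  ext x y
  rw [choi_apply_of_measurePrepare hΛ]
  simp only [measurePrepareExtension, reduceAB, reduceAE, Matrix.of_apply, Matrix.smul_apply,
    Matrix.add_apply, Matrix.submatrix_apply, kroneckerMap_apply, Matrix.transpose_apply,
    Fintype.sum_prod_type, Complex.real_smul, ← Finset.mul_sum, Finset.sum_add_distrib]
  simp only [Finset.sum_mul, Complex.ofReal_inv, Complex.ofReal_pow, Complex.ofReal_natCast]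

/-- The extension is symmetrized over exchanging `Bb` with `Ee`, so its two reductions agree. -/
theorem reduceAE_measurePrepareExtension
    (hΛ : ∀ ρ, Λ ρ = (ρ * reduceAB S).trace • reduceAB T + (ρ * reduceAE S).trace • reduceAE T) :
    reduceAE (measurePrepareExtension S T) = choi Λ := by
  rw [← reduceAB_measurePrepareExtension hΛ]
  ext x y
  simp only [measurePrepareExtension, reduceAB, reduceAE, Matrix.of_apply, Matrix.smul_apply,
    Matrix.add_apply, Matrix.submatrix_apply]
  refine Finset.sum_congr rfl fun e _ => ?_
  rw [add_comm]

theorem IsOneExtendibleMeasurePrepare.isOneExtendibleMap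
    (h : IsOneExtendibleMeasurePrepare Λ) : IsOneExtendibleMap Λ := by
  obtain ⟨S, T, ⟨hS, -⟩, ⟨hT, -⟩, hΛ⟩ := h
  exact ⟨fun r X hX => ampliation_posSemidef_of_measurePrepare hS hT hΛ hX,
    (ampliation_posSemidef_of_measurePrepare hS hT hΛ
      (posSemidef_vecMulVec_self_star _)).submatrix _,
    measurePrepareExtension S T, measurePrepareExtension_posSemidef hS hT,
    reduceAB_measurePrepareExtension hΛ, reduceAE_measurePrepareExtension hΛ⟩

end MeasurePrepare

/-! ### Swaps and Bell operators as a concrete model of the algebra. -/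

section Operators

variable {α : Type*} [DecidableEq α]

/-- The transposition of the systems `A` and `B` of `A ⊗ B ⊗ E`. -/
def swapAB (α : Type*) : Equiv.Perm (α × α × α) where
  toFun z := (z.2.1, z.1, z.2.2)
  invFun z := (z.2.1, z.1, z.2.2)
  left_inv _ := rfl
  right_inv _ := rfl

/-- The transposition of the systems `A` and `E` of `A ⊗ B ⊗ E`. -/
def swapAE (α : Type*) : Equiv.Perm (α × α × α) where
  toFun z := (z.2.2, z.2.1, z.1)
  invFun z := (z.2.2, z.2.1, z.1)
  left_inv _ := rfl
  right_inv _ := rfl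

/-- Twice the maximally entangled projector of the qubits `a` and `b`, on `a ⊗ b ⊗ e`. -/
def bellAB (R : Type*) [Zero R] [One R] : Matrix (Fin 2 × Fin 2 × Fin 2) (Fin 2 × Fin 2 × Fin 2) R :=
  Matrix.of fun x y => if x.1 = x.2.1 ∧ y.1 = y.2.1 ∧ x.2.2 = y.2.2 then 1 else 0

/-- Twice the maximally entangled projector of the qubits `a` and `e`, on `a ⊗ b ⊗ e`. -/
def bellAE (R : Type*) [Zero R] [One R] : Matrix (Fin 2 × Fin 2 × Fin 2) (Fin 2 × Fin 2 × Fin 2) R :=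
  Matrix.of fun x y => if x.1 = x.2.2 ∧ y.1 = y.2.2 ∧ x.2.1 = y.2.1 then 1 else 0

theorem bellAB_map : (bellAB ℤ).map (Int.castRingHom ℂ) = bellAB ℂ := by
  ext x y; simp [bellAB]

theorem bellAE_map : (bellAE ℤ).map (Int.castRingHom ℂ) = bellAE ℂ := by
  ext x y; simp [bellAE]

theorem bellAB_mul_self : bellAB ℂ * bellAB ℂ = (2 : ℂ) • bellAB ℂ := by
  -- The entries are 0 or 1, so the relation is decidable over `ℤ` and transfers to `ℂ` along the
  -- ring homomorphism.
  have h : bellAB ℤ * bellAB ℤ = (2 : ℤ) • bellAB ℤ := by decide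
  have := congrArg (fun M => M.map (Int.castRingHom ℂ)) h
  simp only [Matrix.map_mul, bellAB_map] at this
  rw [this, ← bellAB_map]
  ext x y; simp [-zsmul_eq_mul]

theorem bellAE_mul_self : bellAE ℂ * bellAE ℂ = (2 : ℂ) • bellAE ℂ := by
  have h : bellAE ℤ * bellAE ℤ = (2 : ℤ) • bellAE ℤ := by decide
  have := congrArg (fun M => M.map (Int.castRingHom ℂ)) h
  simp only [Matrix.map_mul, bellAE_map] at this
  rw [this, ← bellAE_map]
  ext x y; simp [-zsmul_eq_mul]

theorem bellAB_mul_bellAE_mul_bellAB : bellAB ℂ * (bellAE ℂ * bellAB ℂ) = bellAB ℂ := by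
  have h : bellAB ℤ * (bellAE ℤ * bellAB ℤ) = bellAB ℤ := by decide
  simpa only [Matrix.map_mul, bellAE_map, bellAB_map] using
    congrArg (fun M => M.map (Int.castRingHom ℂ)) h

theorem bellAE_mul_bellAB_mul_bellAE : bellAE ℂ * (bellAB ℂ * bellAE ℂ) = bellAE ℂ := by
  have h : bellAE ℤ * (bellAB ℤ * bellAE ℤ) = bellAE ℤ := by decide
  simpa only [Matrix.map_mul, bellAE_map, bellAB_map] using
    congrArg (fun M => M.map (Int.castRingHom ℂ)) h

theorem bellAB_isHermitian : (bellAB ℂ).IsHermitian := by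
  ext x y
  simp only [bellAB, conjTranspose_apply, Matrix.of_apply, apply_ite star, star_one, star_zero]
  congr 1
  simp only [eq_comm, eq_iff_iff]; tauto

theorem bellAE_isHermitian : (bellAE ℂ).IsHermitian := by
  ext x y
  simp only [bellAE, conjTranspose_apply, Matrix.of_apply, apply_ite star, star_one, star_zero]
  congr 1
  simp only [eq_comm, eq_iff_iff]; tauto

open scoped Kronecker in
/-- The operator inequality for a Werner state `∝ 1 + g V` and two extensions of Bob's system. -/
theorem posSemidef_werner_extension [Fintype α] {g s : ℝ} (hg : |g| ≤ 1) (hs : 1 / 2 ≤ s)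
    (h : s ^ 2 * (4 - g ^ 2) = 1 + 2 * g ^ 2) :
    ((1 + (g : ℂ) • (swapAB α).permMatrix ℂ) ⊗ₖ ((1 + s : ℂ) • 1 - bellAB ℂ)
      + (1 + (g : ℂ) • (swapAE α).permMatrix ℂ) ⊗ₖ ((1 + s : ℂ) • 1 - bellAE ℂ)).PosSemidef := by
  have hinv : ∀ σ : Equiv.Perm (α × α × α), σ⁻¹ = σ → (σ.permMatrix ℂ).IsHermitian ∧
      σ.permMatrix ℂ * σ.permMatrix ℂ = 1 := by
    intro σ hσ
    refine ⟨by rw [IsHermitian, conjTranspose_permMatrix, hσ], ?_⟩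
    rw [← permMatrix_mul, ← permMatrix_one, mul_eq_one_iff_inv_eq.2 hσ]
  obtain ⟨ha, aa⟩ := hinv (swapAB α) rfl
  obtain ⟨hb, bb⟩ := hinv (swapAE α) rfl
  have bab : (swapAE α).permMatrix ℂ * ((swapAB α).permMatrix ℂ * (swapAE α).permMatrix ℂ)
      = (swapAB α).permMatrix ℂ * ((swapAE α).permMatrix ℂ * (swapAB α).permMatrix ℂ) := by
    simp only [← permMatrix_mul]
    rfl
  have := posSemidef_transposition_temperleyLieb
    (a := (swapAB α).permMatrix ℂ ⊗ₖ (1 : Matrix (Fin 2 × Fin 2 × Fin 2) _ ℂ))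
    (b := (swapAE α).permMatrix ℂ ⊗ₖ (1 : Matrix (Fin 2 × Fin 2 × Fin 2) _ ℂ))
    (e := (1 : Matrix (α × α × α) _ ℂ) ⊗ₖ bellAB ℂ) (f := (1 : Matrix (α × α × α) _ ℂ) ⊗ₖ bellAE ℂ)
    (by rw [IsHermitian, conjTranspose_kronecker, ha.eq, conjTranspose_one])
    (by rw [IsHermitian, conjTranspose_kronecker, hb.eq, conjTranspose_one])
    (by rw [IsHermitian, conjTranspose_kronecker, bellAB_isHermitian.eq, conjTranspose_one])
    (by rw [IsHermitian, conjTranspose_kronecker, bellAE_isHermitian.eq, conjTranspose_one])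
    (by rw [← mul_kronecker_mul, aa, one_mul, one_kronecker_one])
    (by rw [← mul_kronecker_mul, bb, one_mul, one_kronecker_one])
    (by simp only [← mul_kronecker_mul, bab, one_mul])
    (by rw [← mul_kronecker_mul, bellAB_mul_self, one_mul, kronecker_smul])
    (by rw [← mul_kronecker_mul, bellAE_mul_self, one_mul, kronecker_smul])
    (by simp only [← mul_kronecker_mul, bellAB_mul_bellAE_mul_bellAB, one_mul])
    (by simp only [← mul_kronecker_mul, bellAE_mul_bellAB_mul_bellAE, one_mul])
    (by simp only [← mul_kronecker_mul, one_mul, mul_one])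
    (by simp only [← mul_kronecker_mul, one_mul, mul_one])
    (by simp only [← mul_kronecker_mul, one_mul, mul_one])
    (by simp only [← mul_kronecker_mul, one_mul, mul_one])
    hg hs h
  have key : ∀ (V : Matrix (α × α × α) (α × α × α) ℂ)
      (E : Matrix (Fin 2 × Fin 2 × Fin 2) (Fin 2 × Fin 2 × Fin 2) ℂ),
      (1 + (g : ℂ) • V) ⊗ₖ ((1 + s : ℂ) • 1 - E)
        = (1 + (g : ℂ) • (V ⊗ₖ 1)) * ((1 + s : ℂ) • 1 - 1 ⊗ₖ E) := by
    intro V E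
    have h1 : (1 : Matrix (α × α × α) (α × α × α) ℂ) ⊗ₖ ((1 + s : ℂ) • 1 - E)
        = (1 + s : ℂ) • 1 - 1 ⊗ₖ E := by
      rw [sub_eq_add_neg, kronecker_add, kronecker_smul, one_kronecker_one, sub_eq_add_neg,
        ← neg_one_smul ℂ E, kronecker_smul, neg_one_smul]
    have h2 : 1 + (g : ℂ) • (V ⊗ₖ (1 : Matrix (Fin 2 × Fin 2 × Fin 2) _ ℂ))
        = (1 + (g : ℂ) • V) ⊗ₖ (1 : Matrix (Fin 2 × Fin 2 × Fin 2) (Fin 2 × Fin 2 × Fin 2) ℂ) := by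
      rw [add_kronecker, smul_kronecker, one_kronecker_one]
    rw [← h1, h2, ← mul_kronecker_mul, one_mul, mul_one]
  simpa only [key] using this

end Operators

/-! ### The upper bound for 1-extendible maps. -/

theorem wernerStateGamma_apply (d : ℕ) (g : ℝ) (x y : Fin d × Fin d) :
    wernerStateGamma d g x y = ((d : ℂ) ^ 2 + g * d)⁻¹ *
      ((if x = y then 1 else 0) + g * if x.1 = y.2 ∧ x.2 = y.1 then 1 else 0) := by
  simp [wernerStateGamma, swapOp, Matrix.one_apply]

theorem phiPlus_two_apply (x y : Fin 2 × Fin 2) :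
    phiPlus (Fin 2) x y = 1 / 2 * if x.1 = x.2 ∧ y.1 = y.2 then 1 else 0 := by
  have h : ((Real.sqrt 2 : ℝ) : ℂ) * (Real.sqrt 2 : ℝ) = 2 := by
    rw [← Complex.ofReal_mul, Real.mul_self_sqrt zero_le_two]; simp
  by_cases h1 : x.1 = x.2 <;> by_cases h2 : y.1 = y.2 <;>
    simp [phiPlus, vecMulVec_apply, phiVec, h1, h2]
  rw [← mul_inv, h]

open scoped Kronecker in
/-- The operator of `posSemidef_werner_extension`, regrouped as an operator on `Aa ⊗ Bb ⊗ Ee`. -/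
noncomputable def wernerExtensionOp (d : ℕ) (g s : ℝ) :
    Matrix ((Fin d × Fin 2) × (Fin d × Fin 2) × (Fin d × Fin 2))
      ((Fin d × Fin 2) × (Fin d × Fin 2) × (Fin d × Fin 2)) ℂ :=
  ((1 + (g : ℂ) • (swapAB (Fin d)).permMatrix ℂ) ⊗ₖ ((1 + s : ℂ) • 1 - bellAB ℂ)
      + (1 + (g : ℂ) • (swapAE (Fin d)).permMatrix ℂ) ⊗ₖ ((1 + s : ℂ) • 1 - bellAE ℂ)).submatrix
    (fun z => ((z.1.1, z.2.1.1, z.2.2.1), (z.1.2, z.2.1.2, z.2.2.2)))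
    (fun z => ((z.1.1, z.2.1.1, z.2.2.1), (z.1.2, z.2.1.2, z.2.2.2)))

theorem wernerExtensionOp_posSemidef (d : ℕ) {g s : ℝ} (hg : |g| ≤ 1) (hs : 1 / 2 ≤ s)
    (h : s ^ 2 * (4 - g ^ 2) = 1 + 2 * g ^ 2) : (wernerExtensionOp d g s).PosSemidef :=
  (posSemidef_werner_extension hg hs h).submatrix _

theorem wernerExtensionOp_apply (d : ℕ) (g s : ℝ)
    (z w : (Fin d × Fin 2) × (Fin d × Fin 2) × (Fin d × Fin 2)) :
    wernerExtensionOp d g s z w =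
      ((if (z.1.1, z.2.1.1) = (w.1.1, w.2.1.1) then 1 else 0)
          + g * if z.1.1 = w.2.1.1 ∧ z.2.1.1 = w.1.1 then 1 else 0)
        * ((1 + s) * (if (z.1.2, z.2.1.2) = (w.1.2, w.2.1.2) then 1 else 0)
          - if z.1.2 = z.2.1.2 ∧ w.1.2 = w.2.1.2 then 1 else 0)
        * (if z.2.2 = w.2.2 then 1 else 0)
      + ((if (z.1.1, z.2.2.1) = (w.1.1, w.2.2.1) then 1 else 0)
          + g * if z.1.1 = w.2.2.1 ∧ z.2.2.1 = w.1.1 then 1 else 0)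
        * ((1 + s) * (if (z.1.2, z.2.2.2) = (w.1.2, w.2.2.2) then 1 else 0)
          - if z.1.2 = z.2.2.2 ∧ w.1.2 = w.2.2.2 then 1 else 0)
        * (if z.2.1 = w.2.1 then 1 else 0) := by
  obtain ⟨⟨A, a⟩, ⟨B, b⟩, ⟨E, e⟩⟩ := z
  obtain ⟨⟨A', a'⟩, ⟨B', b'⟩, ⟨E', e'⟩⟩ := w
  simp only [wernerExtensionOp, Matrix.submatrix_apply, Matrix.add_apply, kroneckerMap_apply,
    Matrix.sub_apply, Matrix.smul_apply, Matrix.one_apply, bellAB, bellAE, Matrix.of_apply,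
    smul_eq_mul, Equiv.Perm.permMatrix, PEquiv.toMatrix_apply, Equiv.toPEquiv_apply,
    Option.mem_def, Option.some.injEq, swapAB, swapAE, Equiv.coe_fn_mk, Prod.mk.injEq]
  congr 1
  · by_cases h1 : E = E' <;> by_cases h2 : e = e' <;> simp [h1, h2, and_comm]
  · by_cases h1 : B = B' <;> by_cases h2 : b = b' <;> simp [h1, h2, and_comm]

theorem werner_fidelity_gap_nonneg {d : ℕ} (hd : 2 ≤ d) {g s : ℝ} (hg : |g| ≤ 1) (hs : 1 / 2 ≤ s)
    (h : s ^ 2 * (4 - g ^ 2) = 1 + 2 * g ^ 2) {Λ : DistMap d} (hΛ : IsOneExtendible (choi Λ)) :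
    0 ≤ (Λ (wernerStateGamma d g) *
      (((1 + s) / 2 : ℂ) • 1 - phiPlus (Fin 2))).trace := by
  obtain ⟨-, ω, hω, hAB, hAE⟩ := hΛ
  have hd' : (2 : ℝ) ≤ d := by exact_mod_cast hd
  have hg' := abs_le.1 hg
  have hpos : (0 : ℝ) < (d : ℝ) ^ 2 + g * d := by nlinarith
  set ρ := wernerStateGamma d g with hρ
  set Y : Matrix (Fin 2 × Fin 2) (Fin 2 × Fin 2) ℂ := ((1 + s) / 2 : ℂ) • 1 - phiPlus (Fin 2) with hY
  have hYa : ∀ x y, Y x y = 1 / 2 * ((1 + s) * (if y = x then 1 else 0)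
      - if y.1 = y.2 ∧ x.1 = x.2 then 1 else 0) := by
    intro x y
    simp only [eq_comm (a := y), and_comm (a := y.1 = y.2)]
    simp only [hY, Matrix.sub_apply, Matrix.smul_apply, Matrix.one_apply, phiPlus_two_apply,
      smul_eq_mul]
    ring
  set K : Matrix ((Fin d × Fin 2) × (Fin d × Fin 2)) ((Fin d × Fin 2) × (Fin d × Fin 2)) ℂ :=
    Matrix.of fun x y => ρ (x.1.1, x.2.1) (y.1.1, y.2.1) * Y (y.1.2, y.2.2) (x.1.2, x.2.2) with hK
  have h1 : (Λ ρ * Y).trace = (d : ℂ) ^ 2 * ∑ x, ∑ y, choi Λ x y * K x y :=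
    trace_apply_mul_eq_sum_choi (by omega) Λ ρ Y
  have h2 := sum_reduceAB_mul ω K
  have h3 := sum_reduceAE_mul ω K
  rw [hAB] at h2
  rw [hAE] at h3
  have h5 : (Λ ρ * Y).trace = (((d : ℝ) ^ 2 * ((d : ℝ) ^ 2 + g * d)⁻¹ / 4 : ℝ) : ℂ) *
      ∑ z, ∑ w, ω z w * wernerExtensionOp d g s z w := by
    -- The pairing is split into two equal halves so that one can be lifted to `ω` through the `AB`
    -- reduction and the other through the `AE` reduction.
    have h6 : (Λ ρ * Y).trace = (d : ℂ) ^ 2 / 2 * (∑ x, ∑ y, choi Λ x y * K x y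
        + ∑ x, ∑ y, choi Λ x y * K x y) := by rw [h1]; ring
    rw [h6]
    nth_rw 1 [h2]
    rw [h3]
    simp only [← Finset.sum_add_distrib, Finset.mul_sum]
    refine Finset.sum_congr rfl fun z _ => Finset.sum_congr rfl fun w _ => ?_
    simp only [hK, Matrix.of_apply, hρ, wernerStateGamma_apply, hYa, wernerExtensionOp_apply]
    push_cast
    ring
  rw [h5]
  have := (inv_pos.2 hpos).le
  exact mul_nonneg (Complex.zero_le_real.2 (by positivity))
    (hω.sum_mul_nonneg (wernerExtensionOp_posSemidef d hg hs h))

theorem swapOp_isHermitian (d : ℕ) : (swapOp d).IsHermitian := by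
  ext x y
  simp only [swapOp, conjTranspose_apply, Matrix.of_apply, apply_ite star, star_one, star_zero]
  congr 1
  simp only [eq_comm, eq_iff_iff]; tauto

theorem swapOp_mul_self (d : ℕ) : swapOp d * swapOp d = 1 := by
  ext x y
  have h : ∀ z : Fin d × Fin d, (x.1 = z.2 ∧ x.2 = z.1) ↔ z = (x.2, x.1) := by
    intro z; rw [Prod.ext_iff]; constructor <;> rintro ⟨h1, h2⟩ <;> simp [h1, h2]
  simp only [swapOp, Matrix.mul_apply, Matrix.of_apply, h, ite_mul, one_mul, zero_mul,
    Finset.sum_ite_eq', Finset.mem_univ, if_true, Matrix.one_apply]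
  congr 1
  rw [eq_iff_iff, Prod.ext_iff]; tauto

theorem wernerStateGamma_posSemidef {d : ℕ} (hd : 2 ≤ d) {g : ℝ} (hg : |g| ≤ 1) :
    (wernerStateGamma d g).PosSemidef := by
  have hd' : (2 : ℝ) ≤ d := by exact_mod_cast hd
  have hg' := abs_le.1 hg
  have hpos : (0 : ℝ) < (d : ℝ) ^ 2 + g * d := by nlinarith
  convert (posSemidef_one_add_smul (swapOp_isHermitian d) (swapOp_mul_self d) hg).smul
    (inv_nonneg.2 hpos.le) using 1
  ext x y
  simp [wernerStateGamma, mul_add]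

/-- No one-extendible map beats the fidelity `(1 + s) / 2`. -/
theorem fidelity_le_of_isOneExtendibleMap {d : ℕ} (hd : 2 ≤ d) {g s : ℝ} (hg : |g| ≤ 1)
    (hs : 1 / 2 ≤ s) (h : s ^ 2 * (4 - g ^ 2) = 1 + 2 * g ^ 2) {Λ : DistMap d}
    (hΛ : IsOneExtendibleMap Λ) (h0 : (Λ (wernerStateGamma d g)).trace ≠ 0) :
    fidelity (wernerStateGamma d g) Λ ≤ (1 + s) / 2 := by
  have h1 := werner_fidelity_gap_nonneg hd hg hs h hΛ.2
  -- A one-dimensional ancilla extracts plain positivity of `Λ` from complete positivity.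
  have h2 : (Λ (wernerStateGamma d g)).PosSemidef :=
    (hΛ.1 1 _ ((wernerStateGamma_posSemidef hd hg).submatrix Prod.snd)).submatrix
      (fun m => ((0 : Fin 1), m))
  have h3 := h2.trace_nonneg
  rw [mul_sub, trace_sub, mul_smul_comm, mul_one, trace_smul, smul_eq_mul] at h1
  rw [fidelity]
  generalize (Λ (wernerStateGamma d g)).trace = t at *
  generalize (Λ (wernerStateGamma d g) * phiPlus (Fin 2)).trace = n at *
  obtain ⟨hre, him⟩ := Complex.nonneg_iff.1 h3
  have ht : t = (t.re : ℂ) := Complex.ext rfl (by simp [← him])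
  have hre' : 0 < t.re := lt_of_le_of_ne hre fun h => h0 (by rw [ht, ← h]; simp)
  rw [ht] at h1 ⊢
  rw [Complex.div_ofReal_re, div_le_iff₀ hre']
  have := (Complex.nonneg_iff.1 h1).1
  rw [show ((1 + s : ℂ) / 2) = (((1 + s) / 2 : ℝ) : ℂ) by push_cast; rfl, Complex.sub_re,
    ← Complex.ofReal_mul, Complex.ofReal_re] at this
  linarith

/-! ### An optimal measure-and-prepare map. -/

/-- The vector with real amplitudes `p i` at the basis vectors `v i`. -/
noncomputable def tripleVec {α : Type*} [DecidableEq α] (v : Fin 3 → α) (p : Fin 3 → ℝ) : α → ℂ :=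
  fun z => ∑ i, if z = v i then (p i : ℂ) else 0

/-- The pure state of `tripleVec`. -/
noncomputable def tripleState {α : Type*} [DecidableEq α] (v : Fin 3 → α) (p : Fin 3 → ℝ) :
    Matrix α α ℂ :=
  vecMulVec (tripleVec v p) (star (tripleVec v p))

section Triple

variable {α : Type*} [Fintype α] [DecidableEq α]

theorem sum_tripleState_mul (v : Fin 3 → α) (p : Fin 3 → ℝ) (K : α → α → ℂ) :
    ∑ z, ∑ w, tripleState v p z w * K z w = ∑ i, ∑ j, (p i : ℂ) * p j * K (v i) (v j) := by
  have h1 : ∀ f : α → ℂ, ∑ z, tripleVec v p z * f z = ∑ i, (p i : ℂ) * f (v i) := by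
    intro f
    simp only [tripleVec, Finset.sum_mul, ite_mul, zero_mul]
    rw [Finset.sum_comm]
    simp
  have h2 : star (tripleVec v p) = tripleVec v p := by
    ext z
    simp [tripleVec, apply_ite (starRingEnd ℂ)]
  simp only [tripleState, vecMulVec_apply, h2, mul_assoc, ← Finset.mul_sum, h1]

theorem isState_tripleState (v : Fin 3 → α) (hv : Function.Injective v) (p : Fin 3 → ℝ)
    (hp : p 0 ^ 2 + p 1 ^ 2 + p 2 ^ 2 = 1) : IsState (tripleState v p) := by
  refine ⟨posSemidef_vecMulVec_self_star _, ?_⟩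
  have h := sum_tripleState_mul v p fun z w => if z = w then 1 else 0
  simp only [mul_ite, mul_one, mul_zero, Finset.sum_ite_eq, Finset.mem_univ,
    if_true, hv.eq_iff] at h
  rw [Matrix.trace]
  refine h.trans ?_
  rw [Fin.sum_univ_three]
  norm_cast
  linarith

end Triple

theorem trace_reduceAB {A B E : Type*} [Fintype A] [Fintype B] [Fintype E]
    (σ : Matrix (A × B × E) (A × B × E) ℂ) : (reduceAB σ).trace = σ.trace := by
  simp [Matrix.trace, reduceAB, Fintype.sum_prod_type]

theorem trace_reduceAE {A B E : Type*} [Fintype A] [Fintype B] [Fintype E]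
    (σ : Matrix (A × B × E) (A × B × E) ℂ) : (reduceAE σ).trace = σ.trace := by
  simp only [Matrix.trace, reduceAE, Fintype.sum_prod_type, Matrix.diag_apply, Matrix.of_apply]
  exact Finset.sum_congr rfl fun a _ => Finset.sum_comm

theorem trace_mul_eq_sum_mul_transpose {n : Type*} [Fintype n] (A S : Matrix n n ℂ) :
    (A * S).trace = ∑ x, ∑ y, S x y * Aᵀ x y := by
  rw [trace_mul_comm]
  simp [Matrix.trace, Matrix.mul_apply]

section Attain

variable {d : ℕ} {i₀ i₁ : Fin d}

theorem trace_werner_reduceAB (hi : i₀ ≠ i₁) (g : ℝ) (p : Fin 3 → ℝ)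
    (hp : p 0 ^ 2 + p 1 ^ 2 + p 2 ^ 2 = 1) :
    (wernerStateGamma d g *
      reduceAB (tripleState ![(i₁, i₀, i₀), (i₀, i₁, i₀), (i₀, i₀, i₁)] p)).trace
      = (((d : ℝ) ^ 2 + g * d)⁻¹ * (1 + g * (2 * p 0 * p 1 + p 2 ^ 2)) : ℝ) := by
  rw [trace_mul_eq_sum_mul_transpose, sum_reduceAB_mul]
  refine (sum_tripleState_mul _ _ _).trans ?_
  simp [Fin.sum_univ_three, wernerStateGamma_apply, hi, hi.symm]
  have hpc : (p 0 : ℂ) ^ 2 + (p 1 : ℂ) ^ 2 + (p 2 : ℂ) ^ 2 = 1 := by exact_mod_cast hp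
  linear_combination ((d : ℂ) ^ 2 + g * d)⁻¹ * hpc

theorem trace_werner_reduceAE (hi : i₀ ≠ i₁) (g : ℝ) (p : Fin 3 → ℝ)
    (hp : p 0 ^ 2 + p 1 ^ 2 + p 2 ^ 2 = 1) :
    (wernerStateGamma d g *
      reduceAE (tripleState ![(i₁, i₀, i₀), (i₀, i₁, i₀), (i₀, i₀, i₁)] p)).trace
      = (((d : ℝ) ^ 2 + g * d)⁻¹ * (1 + g * (2 * p 0 * p 2 + p 1 ^ 2)) : ℝ) := by
  rw [trace_mul_eq_sum_mul_transpose, sum_reduceAE_mul]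
  refine (sum_tripleState_mul _ _ _).trans ?_
  simp [Fin.sum_univ_three, wernerStateGamma_apply, hi, hi.symm]
  have hpc : (p 0 : ℂ) ^ 2 + (p 1 : ℂ) ^ 2 + (p 2 : ℂ) ^ 2 = 1 := by exact_mod_cast hp
  linear_combination ((d : ℂ) ^ 2 + g * d)⁻¹ * hpc

/-- The vectors 000, 110, 101 are the weight-one vectors with qubit `a` flipped. A sign on the first
amplitude then turns the overlap with the singlet into the overlap with `ϕ₊`. -/
theorem trace_reduceAB_mul_phiPlus (r : Fin 3 → ℝ) :
    (reduceAB (tripleState (![(0, 0, 0), (1, 1, 0), (1, 0, 1)] : Fin 3 → Fin 2 × Fin 2 × Fin 2) r)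
      * phiPlus (Fin 2)).trace = (((r 0 + r 1) ^ 2 / 2 : ℝ) : ℂ) := by
  rw [trace_mul_comm, trace_mul_eq_sum_mul_transpose, sum_reduceAB_mul]
  refine (sum_tripleState_mul _ _ _).trans ?_
  simp [Fin.sum_univ_three, phiPlus_two_apply]
  ring

theorem trace_reduceAE_mul_phiPlus (r : Fin 3 → ℝ) :
    (reduceAE (tripleState (![(0, 0, 0), (1, 1, 0), (1, 0, 1)] : Fin 3 → Fin 2 × Fin 2 × Fin 2) r)
      * phiPlus (Fin 2)).trace = (((r 0 + r 2) ^ 2 / 2 : ℝ) : ℂ) := by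
  rw [trace_mul_comm, trace_mul_eq_sum_mul_transpose, sum_reduceAE_mul]
  refine (sum_tripleState_mul _ _ _).trans ?_
  simp [Fin.sum_univ_three, phiPlus_two_apply]
  ring

end Attain

/-- The measure-and-prepare map of two tripartite operators. -/
def measurePrepareMap {d : ℕ} (S : Matrix (Fin d × Fin d × Fin d) (Fin d × Fin d × Fin d) ℂ)
    (T : Matrix (Fin 2 × Fin 2 × Fin 2) (Fin 2 × Fin 2 × Fin 2) ℂ) : DistMap d where
  toFun ρ := (ρ * reduceAB S).trace • reduceAB T + (ρ * reduceAE S).trace • reduceAE T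
  map_add' x y := by simp only [add_mul, trace_add, add_smul]; abel
  map_smul' c x := by simp only [smul_mul_assoc, trace_smul, smul_assoc, smul_add, RingHom.id_apply]

theorem exists_half_angle {z x : ℝ} (h : z ^ 2 + x ^ 2 = 1) :
    ∃ u v : ℝ, u ^ 2 + v ^ 2 = 1 ∧ u ^ 2 - v ^ 2 = z ∧ 2 * u * v = x := by
  have hz : -1 ≤ z := by nlinarith [sq_nonneg x]
  -- At `z = -1` the half-angle cosine `u` vanishes, and `v = x / (2u)` is not available.
  rcases hz.eq_or_lt with rfl | hz
  · exact ⟨0, 1, by norm_num, by norm_num, by nlinarith⟩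
  have hu : 0 < √((1 + z) / 2) := Real.sqrt_pos.2 (by linarith)
  have hu2 : √((1 + z) / 2) ^ 2 = (1 + z) / 2 := Real.sq_sqrt (by linarith)
  have hv : (x / (2 * √((1 + z) / 2))) ^ 2 = (1 - z) / 2 := by
    rw [div_pow, mul_pow, hu2, div_eq_iff (by linarith)]
    linarith
  exact ⟨√((1 + z) / 2), x / (2 * √((1 + z) / 2)), by rw [hv, hu2]; ring, by rw [hv, hu2]; ring,
    by field_simp⟩

/-- Amplitudes on three weight-one basis vectors, orthogonal to the symmetric one. -/
theorem exists_amplitudes {z x : ℝ} (h : z ^ 2 + x ^ 2 = 1) :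
    ∃ p : Fin 3 → ℝ, p 0 ^ 2 + p 1 ^ 2 + p 2 ^ 2 = 1 ∧
      2 * p 0 * p 1 + p 2 ^ 2 = z / 2 + √3 / 2 * x ∧
      2 * p 0 * p 2 + p 1 ^ 2 = z / 2 - √3 / 2 * x := by
  obtain ⟨u, v, h1, h2, h3⟩ := exists_half_angle h
  have s2 : √2 ^ 2 = 2 := Real.sq_sqrt (by norm_num)
  have s3 : √3 ^ 2 = 3 := Real.sq_sqrt (by norm_num)
  -- These are the coordinates of `u(0, 1, -1)/√2 + v(2, -1, -1)/√6`; the swaps act on this plane as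
  -- reflections, whence the double angle `(z, x)`.
  refine ⟨![√2 * √3 / 3 * v, √2 / 2 * u - √2 * √3 / 6 * v, -(√2 / 2 * u) - √2 * √3 / 6 * v],
    ?_, ?_, ?_⟩ <;> simp <;> subst h2 h3
  · ring_nf; simp only [s2, s3]; linarith
  · ring_nf; simp only [s2, s3]; ring
  · ring_nf; simp only [s2, s3]; ring

/-- The fidelity `(1 + s) / 2` is attained by a one-extendible measure-and-prepare map. -/
theorem exists_measurePrepare_fidelity {d : ℕ} (hd : 2 ≤ d) {g s : ℝ} (hg : |g| ≤ 1)
    (hs : 1 / 2 ≤ s) (h : s ^ 2 * (4 - g ^ 2) = 1 + 2 * g ^ 2) :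
    ∃ Λ : DistMap d, IsOneExtendibleMeasurePrepare Λ ∧ (Λ (wernerStateGamma d g)).trace ≠ 0 ∧
      (1 + s) / 2 = fidelity (wernerStateGamma d g) Λ := by
  have hd' : (2 : ℝ) ≤ d := by exact_mod_cast hd
  have hg' := abs_le.1 hg
  have hpos : (0 : ℝ) < (d : ℝ) ^ 2 + g * d := by nlinarith
  have hg2 : g ^ 2 ≤ 1 := by nlinarith
  have hr : 0 < √(4 - g ^ 2) := Real.sqrt_pos.2 (by linarith)
  have hr2 : √(4 - g ^ 2) ^ 2 = 4 - g ^ 2 := Real.sq_sqrt (by linarith)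
  set r := √(4 - g ^ 2)
  have s3 : √3 ^ 2 = 3 := Real.sq_sqrt (by norm_num)
  -- After the output state is optimized, the squared excess `(2F - 1)²` is `1/4 + 9g²(1 - z²)/(4(2
  -- + gz)²)`, which is stationary at `z = -g/2`; then `x = r/2` completes a unit vector.
  obtain ⟨p, hp, hp1, hp2⟩ := exists_amplitudes (z := -g / 2) (x := r / 2) (by nlinarith)
  -- For fixed `p` the fidelity is affine in the output vector, and the best choice is the unit
  -- vector opposite to `(1 + gz/2, 3gx/2)`, which is proportional to `(r, 3g)`.
  obtain ⟨q, hq, hq1, hq2⟩ := exists_amplitudes (z := -1 / (2 * s)) (x := -3 * g / (2 * s * r))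
    (by
      have : s ^ 2 * r ^ 2 = 1 + 2 * g ^ 2 := by rw [hr2, h]
      have hs0 : s ≠ 0 := by linarith
      field_simp
      rw [hr2]
      linarith)
  let i₀ : Fin d := ⟨0, by omega⟩
  let i₁ : Fin d := ⟨1, by omega⟩
  have hi : i₀ ≠ i₁ := by simp [i₀, i₁]
  set S := tripleState ![(i₁, i₀, i₀), (i₀, i₁, i₀), (i₀, i₀, i₁)] p with hS
  set T := tripleState (![(0, 0, 0), (1, 1, 0), (1, 0, 1)] : Fin 3 → Fin 2 × Fin 2 × Fin 2)
    ![-q 0, q 1, q 2] with hT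
  have hSs : IsState S := isState_tripleState _ (by
    intro a b hab
    fin_cases a <;> fin_cases b <;> simp_all [hi.symm]) p hp
  have hTs : IsState T := isState_tripleState _ (by decide) _ (by simpa using hq)
  refine ⟨measurePrepareMap S T, ⟨S, T, hSs, hTs, fun _ => rfl⟩, ?_, ?_⟩
  all_goals
    set A := ((d : ℝ) ^ 2 + g * d)⁻¹ * (1 + g * (2 * p 0 * p 1 + p 2 ^ 2)) with hA
    set B := ((d : ℝ) ^ 2 + g * d)⁻¹ * (1 + g * (2 * p 0 * p 2 + p 1 ^ 2)) with hB
    have hΛ : measurePrepareMap S T (wernerStateGamma d g)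
        = (A : ℂ) • reduceAB T + (B : ℂ) • reduceAE T := by
      rw [hA, hB, ← trace_werner_reduceAB hi g p hp, ← trace_werner_reduceAE hi g p hp]
      rfl
    have htr : (measurePrepareMap S T (wernerStateGamma d g)).trace = ((A + B : ℝ) : ℂ) := by
      rw [hΛ, trace_add, trace_smul, trace_smul, trace_reduceAB, trace_reduceAE, hTs.2]
      simp
    have hAB : A + B = ((d : ℝ) ^ 2 + g * d)⁻¹ * (2 - g ^ 2 / 2) := by
      rw [hA, hB, hp1, hp2]; ring
    have hAB0 : A + B ≠ 0 := by
      rw [hAB]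
      exact mul_ne_zero (inv_ne_zero hpos.ne') (by linarith)
  · rw [htr]
    exact_mod_cast hAB0
  · have hn : (measurePrepareMap S T (wernerStateGamma d g) * phiPlus (Fin 2)).trace
        = ((A * ((-q 0 + q 1) ^ 2 / 2) + B * ((-q 0 + q 2) ^ 2 / 2) : ℝ) : ℂ) := by
      rw [hΛ, add_mul, trace_add, smul_mul_assoc, smul_mul_assoc, trace_smul, trace_smul,
        trace_reduceAB_mul_phiPlus, trace_reduceAE_mul_phiPlus]
      simp
    rw [fidelity, htr, hn, ← Complex.ofReal_div, Complex.ofReal_re, eq_div_iff hAB0]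
    have e1 : (-q 0 + q 1) ^ 2 = 1 - (2 * q 0 * q 1 + q 2 ^ 2) := by linarith
    have e2 : (-q 0 + q 2) ^ 2 = 1 - (2 * q 0 * q 2 + q 1 ^ 2) := by linarith
    rw [hAB, hA, hB, e1, e2, hp1, hp2, hq1, hq2]
    have hs0 : s ≠ 0 := by linarith
    obtain ⟨k, hk⟩ : ∃ k, k = 1 / (2 * s) := ⟨_, rfl⟩
    obtain ⟨w, hw⟩ : ∃ w, w = 3 * g / (2 * s * r) := ⟨_, rfl⟩
    have hk2 : 2 * s * k = 1 := by rw [hk]; field_simp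
    have hw2 : w * r = 3 * g * k := by rw [hk, hw]; field_simp
    rw [show -1 / (2 * s) = -k by rw [hk]; ring, show -3 * g / (2 * s * r) = -w by rw [hw]; ring]
    linear_combination ((d : ℝ) ^ 2 + g * d)⁻¹ * (-(g * r * w / 8) * s3 - 3 * g / 8 * hw2
      + k / 2 * h - s * (4 - g ^ 2) / 4 * hk2)

/-! ### Translating between the parameters `p` and `γ`. -/

theorem wernerGamma_abs_le {d : ℕ} (hd : 2 ≤ d) {p : ℝ} (hp0 : 0 ≤ p) (hp1 : p ≤ 1) :
    |wernerGamma p d| ≤ 1 := by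
  have hd' : (2 : ℝ) ≤ d := by exact_mod_cast hd
  have hm : 2 * p - d - 1 < 0 := by linarith
  rw [wernerGamma, abs_neg, abs_div, div_le_one (abs_pos.2 hm.ne), ← sq_le_sq]
  -- The difference of the squared denominator and the squared numerator of `γ` is `4p(1 - p)(d² -
  -- 1)`.
  have := mul_nonneg (mul_nonneg hp0 (sub_nonneg.2 hp1)) (show (0 : ℝ) ≤ (d : ℝ) ^ 2 - 1 by nlinarith)
  nlinarith

theorem wernerState_eq_wernerStateGamma {d : ℕ} (hd : 2 ≤ d) {p : ℝ} (hp1 : p ≤ 1) :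
    wernerState d p = wernerStateGamma d (wernerGamma p d) := by
  have hd' : (2 : ℝ) ≤ d := by exact_mod_cast hd
  have hm : 2 * p - d - 1 ≠ 0 := by linarith
  have h0 : (d : ℝ) ≠ 0 := by linarith
  have h1 : (d : ℝ) + 1 ≠ 0 := by linarith
  have h2 : (d : ℝ) - 1 ≠ 0 := by linarith
  have hN : (d : ℝ) ^ 2 + wernerGamma p d * d
      = -(d * ((d : ℝ) + 1) * (d - 1)) / (2 * p - d - 1) := by
    rw [wernerGamma]; field_simp; ring
  have e1 : p / ((d : ℝ) * (d + 1) / 2) * (1 / 2) + (1 - p) / ((d : ℝ) * (d - 1) / 2) * (1 / 2)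
      = ((d : ℝ) ^ 2 + wernerGamma p d * d)⁻¹ := by
    rw [hN]; field_simp; ring
  have e2 : p / ((d : ℝ) * (d + 1) / 2) * (1 / 2) - (1 - p) / ((d : ℝ) * (d - 1) / 2) * (1 / 2)
      = ((d : ℝ) ^ 2 + wernerGamma p d * d)⁻¹ * wernerGamma p d := by
    rw [hN, wernerGamma]
    generalize 2 * p - d - 1 = m at hm
    field_simp
    ring
  have e1' := congrArg (fun x : ℝ => (x : ℂ)) e1
  have e2' := congrArg (fun x : ℝ => (x : ℂ)) e2
  push_cast at e1' e2'
  rw [wernerState, symProj, asymProj, wernerStateGamma, smul_add (_ : ℂ) 1 (_ • swapOp d), smul_smul _ _ (swapOp d)]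
  push_cast
  rw [← e2', ← e1']
  module

theorem three_mul_wernerF_sq_add_one {d : ℕ} (hd : 2 ≤ d) {p : ℝ} (hp0 : 0 ≤ p) (hp1 : p ≤ 1) :
    3 * wernerF p d ^ 2 + 1
      = 4 * ((1 + 2 * wernerGamma p d ^ 2) / (4 - wernerGamma p d ^ 2)) := by
  have hd' : (2 : ℝ) ≤ d := by exact_mod_cast hd
  have hm : 2 * p - d - 1 < 0 := by linarith
  have h1 : 0 < 2 * ((d : ℝ) - 2) * p + d + 1 := by
    have := mul_nonneg (sub_nonneg.2 hd') hp0
    linarith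
  have h2 : 0 < 3 * ((d : ℝ) + 1) - 2 * ((d : ℝ) + 2) * p := by
    have := mul_nonneg (show (0 : ℝ) ≤ (d : ℝ) + 2 by linarith) (sub_nonneg.2 hp1)
    linarith
  have h3 := mul_pos h1 h2
  rw [wernerF, div_pow, mul_pow, Real.sq_sqrt (by norm_num), sq_abs, Real.sq_sqrt h3.le, wernerGamma]
  -- Writing `γ = -k/m`, the radicand in `f` factors as `4m² - k²`, so it equals `m²(4 - γ²)`.
  have hQ : (2 * ((d : ℝ) - 2) * p + d + 1) * (3 * ((d : ℝ) + 1) - 2 * ((d : ℝ) + 2) * p)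
      = 4 * (2 * p - d - 1) ^ 2 - (2 * d * p - d - 1) ^ 2 := by ring
  rw [show -2 * (d : ℝ) * p + d + 1 = -(2 * d * p - d - 1) by ring]
  generalize (2 * ((d : ℝ) - 2) * p + d + 1) * (3 * ((d : ℝ) + 1) - 2 * ((d : ℝ) + 2) * p) = Q at *
  generalize 2 * p - (d : ℝ) - 1 = m at *
  generalize 2 * (d : ℝ) * p - d - 1 = k at *
  have hm' := hm.ne
  have hQ' := h3.ne'
  have h4 : 4 - (-(k / m)) ^ 2 = Q / m ^ 2 := by
    rw [hQ]
    field_simp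
  rw [h4]
  field_simp
  linear_combination hQ

theorem mainTheorem6 (d : ℕ) (hd : 2 ≤ d) (p : ℝ) (hp0 : 0 ≤ p) (hp1 : p ≤ 1) :
    IsGreatest (achievableFidelities IsOneExtendibleMeasurePrepare (wernerState d p))
      ((1 / 4) * (Real.sqrt (3 * wernerF p d ^ 2 + 1) + 2)) ∧
    IsGreatest (achievableFidelities IsOneExtendibleMap (wernerState d p))
      ((1 / 4) * (Real.sqrt (3 * wernerF p d ^ 2 + 1) + 2)) ∧
    wernerState d p = wernerStateGamma d (wernerGamma p d) ∧
    (1 / 4) * (Real.sqrt (3 * wernerF p d ^ 2 + 1) + 2) =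
      1 / 2 + 1 / 2 *
        Real.sqrt ((1 + 2 * wernerGamma p d ^ 2) / (4 - wernerGamma p d ^ 2)) := by
  have hg := wernerGamma_abs_le hd hp0 hp1
  have hW := wernerState_eq_wernerStateGamma hd hp1
  have hF : (1 / 4) * (Real.sqrt (3 * wernerF p d ^ 2 + 1) + 2) = 1 / 2 + 1 / 2 *
      Real.sqrt ((1 + 2 * wernerGamma p d ^ 2) / (4 - wernerGamma p d ^ 2)) := by
    rw [three_mul_wernerF_sq_add_one hd hp0 hp1, Real.sqrt_mul (by norm_num),
      show √(4 : ℝ) = 2 by rw [show (4 : ℝ) = 2 ^ 2 by norm_num, Real.sqrt_sq (by norm_num)]]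
    ring
  refine ⟨?_, ?_, hW, hF⟩
  all_goals
    rw [hF, hW]
    generalize wernerGamma p d = g at *
    have hg2 : g ^ 2 ≤ 1 := (sq_le_one_iff_abs_le_one g).2 hg
    have hq : 1 / 4 ≤ (1 + 2 * g ^ 2) / (4 - g ^ 2) := by
      rw [le_div_iff₀ (by linarith)]; nlinarith [sq_nonneg g]
    have h : √((1 + 2 * g ^ 2) / (4 - g ^ 2)) ^ 2 * (4 - g ^ 2) = 1 + 2 * g ^ 2 := by
      rw [Real.sq_sqrt (by linarith), div_mul_cancel₀ _ (by linarith)]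
    have hs : 1 / 2 ≤ √((1 + 2 * g ^ 2) / (4 - g ^ 2)) := Real.le_sqrt_of_sq_le (by linarith)
    generalize √((1 + 2 * g ^ 2) / (4 - g ^ 2)) = s at *
    rw [show 1 / 2 + 1 / 2 * s = (1 + s) / 2 by ring]
    obtain ⟨Λ, hΛ, hΛ0, hΛF⟩ := exists_measurePrepare_fidelity hd hg hs h
  · refine ⟨⟨Λ, hΛ, hΛ0, hΛF⟩, ?_⟩
    rintro _ ⟨Λ', hΛ', h0, rfl⟩
    exact fidelity_le_of_isOneExtendibleMap hd hg hs h hΛ'.isOneExtendibleMap h0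
  · refine ⟨⟨Λ, hΛ.isOneExtendibleMap, hΛ0, hΛF⟩, ?_⟩
    rintro _ ⟨Λ', hΛ', h0, rfl⟩
    exact fidelity_le_of_isOneExtendibleMap hd hg hs h hΛ' h0
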